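/- Let $P$ be a simple $d$-polytope, that is, a $d$-dimensional convex polytope each of whose vertices is incident to exactly $d$ edges, and let $G(P)$ be its graph, whose nodes are the vertices of $P$ and whose edges are the edges of $P$. Let $2\le k\le d-1$. Let $V_k(P)$ be the set of vertex sets of the $k$-faces of $P$, and let $f_k(P)=|V_k(P)|$ be the number of $k$-faces of $P$. A $k$-frame is a (not necessarily induced) subgraph of $G(P)$ isomorphic to the star $K_{1,k}$. A $k$-system of $G(P)$ is a set $\mathcal S$ of nonempty subsets of the vertex set of $P$ such that for each $S\in\mathcal S$ the subgraph of $G(P)$ induced by $S$ is $k$-regular, and such that the node set of every $k$-frame is contained in exactly one member of $\mathcal S$. For an acyclic orientation $\mathcal O$ of $G(P)$, let $h_i(\mathcal O)$ be the number of vertices with precisely $i$ incident edges directed inwards, and put $$H_k(\mathcal O)=\sum_{i=0}^{d} h_i(\mathcal O)\binom{i}{k}.$$ Then for every $k$-system $\mathcal S$ of $G(P)$ and every acyclic orientation $\mathcal O$ of $G(P)$, $$|\mathcal S|\ \le\ f_k(P)\ \le\ H_k(\mathcal O).$$ The first inequality is an equality if and only if $\mathcal S=V_k(P)$. The second inequality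 is an equality if and only if, for every $k$-face $F$ of $P$, the orientation that $\mathcal O$ induces on the subgraph of $G(P)$ induced by the vertices of $F$ has precisely one sink. -/

import Mathlib

/-! ### Polytopes, faces and the graph of a polytope -/

section Polytope

variable {E : Type*} [NormedAddCommGroup E] [NormedSpace ℝ E]

/-- A (convex) polytope: the convex hull of a finite set of points. -/
def IsPolytope (P : Set E) : Prop :=
  ∃ s : Set E, s.Finite ∧ P = convexHull ℝ s

/-- The dimension of a set: the dimension of its affine hull. -/
noncomputable def polyDim (P : Set E) : ℕ :=
  Module.finrank ℝ (vectorSpan ℝ P)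

/-- `F` is a `k`-face of `P`: a nonempty subset of dimension `k` that is the set of maximizers
over `P` of some linear functional. -/
structure IsKFace (P : Set E) (k : ℕ) (F : Set E) : Prop where
  nonempty : F.Nonempty
  exposed : IsExposed ℝ P F
  dim_eq : polyDim F = k

/-- The vertices of `P`: the points `v` such that `{v}` is a `0`-face of `P`. -/
def polyVertices (P : Set E) : Set E :=
  {v | IsKFace P 0 {v}}

/-- The graph of `P`: the nodes are the vertices of `P`, and two distinct vertices are adjacent
if the segment between them is a `1`-face (an edge) of `P`. -/
def polyGraph (P : Set E) : SimpleGraph (polyVertices P) where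
  Adj u v := u ≠ v ∧ IsKFace P 1 (segment ℝ (u : E) (v : E))
  symm := ⟨fun u v h => ⟨h.1.symm, by rw [segment_symm]; exact h.2⟩⟩
  loopless := ⟨fun _ h => h.1 rfl⟩

/-- A simple `d`-polytope: a polytope of dimension `d` each of whose vertices is incident to
exactly `d` edges. -/
structure IsSimplePolytope (P : Set E) (d : ℕ) : Prop where
  polytope : IsPolytope P
  dim_eq : polyDim P = d
  degree_eq : ∀ v : polyVertices P, ((polyGraph P).neighborSet v).ncard = d

/-- The vertex set of a face `F` of `P`, as a set of nodes of the graph of `P`: the vertices of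
`P` that lie in `F`. -/
def faceVerts (P : Set E) (F : Set E) : Set (polyVertices P) :=
  {v | (v : E) ∈ F}

/-- The set of vertex sets of the `k`-faces of `P`. -/
def kFaceVerts (P : Set E) (k : ℕ) : Set (Set (polyVertices P)) :=
  {W | ∃ F : Set E, IsKFace P k F ∧ W = faceVerts P F}

/-- The number of `k`-faces of `P`, as the number of their vertex sets. -/
noncomputable def fNum (P : Set E) (k : ℕ) : ℕ :=
  (kFaceVerts P k).ncard

/-- A polytope has finitely many vertices, so all cardinalities taken here are of finite sets. -/
theorem IsPolytope.finite_polyVertices {P : Set E} (hP : IsPolytope P) :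
    (polyVertices P).Finite := by
  obtain ⟨s, hs, rfl⟩ := hP
  refine hs.subset fun v hv => extremePoints_convexHull_subset (𝕜 := ℝ) ?_
  have h : IsExposed ℝ (convexHull ℝ s) {v} := hv.exposed
  exact isExtreme_singleton.1 h.isExtreme

end Polytope

/-! ### Frames, `k`-systems and acyclic orientations of a graph -/

section Graph

variable {V : Type*}

/-- A `k`-frame of `G`: a (not necessarily induced) subgraph isomorphic to the star `K_{1,k}`. -/
def IsKFrame (G : SimpleGraph V) (k : ℕ) (H : G.Subgraph) : Prop :=
  Nonempty (H.coe ≃g completeBipartiteGraph (Fin 1) (Fin k))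

/-- A `k`-system of `G`: a set of nonempty sets of nodes, each inducing a `k`-regular subgraph,
such that the node set of every `k`-frame of `G` is contained in exactly one of them. -/
structure IsKSystem (G : SimpleGraph V) (k : ℕ) (𝒮 : Set (Set V)) : Prop where
  nonempty : ∀ S ∈ 𝒮, S.Nonempty
  regular : ∀ S ∈ 𝒮, ∀ v : S, ((G.induce S).neighborSet v).ncard = k
  frame : ∀ H : G.Subgraph, IsKFrame G k H → ∃! S : Set V, S ∈ 𝒮 ∧ H.verts ⊆ S

/-- An acyclic orientation of `G`, where `O u v` means that the edge `{u, v}` is directed from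
`u` to `v`: every edge receives exactly one direction, and there is no directed cycle. -/
structure IsAcyclicOrientation (G : SimpleGraph V) (O : V → V → Prop) : Prop where
  adj_iff : ∀ u v, G.Adj u v ↔ O u v ∨ O v u
  asymm : ∀ u v, O u v → ¬ O v u
  acyclic : ∀ v, ¬ Relation.TransGen O v v

/-- `v` is a sink of the orientation induced by `O` on the subgraph induced by `W`. -/
def IsSinkOn (O : V → V → Prop) (W : Set V) (v : V) : Prop :=
  v ∈ W ∧ ∀ w ∈ W, ¬ O v w

/-- The number of nodes with precisely `i` incident edges directed inwards. -/
noncomputable def hNum (O : V → V → Prop) (i : ℕ) : ℕ :=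
  {v : V | {u : V | O u v}.ncard = i}.ncard

/-- `H_k(O) = ∑_{i=0}^{d} h_i(O) * (i choose k)`. -/
noncomputable def HkSum (d k : ℕ) (O : V → V → Prop) : ℕ :=
  ∑ i ∈ Finset.range (d + 1), hNum O i * Nat.choose i k

end Graph

/-! Count pairs (S, v) with v a sink of a member S of a `k`-system. By regularity, v is a sink of S
exactly when S contains k in-neighbours of v, and by the frame axiom every k-set of in-neighbours of
v arises from exactly one S. So v is a sink of C(indeg v, k) members, and H_k(O) is the total number
of sinks over all members. Acyclicity gives each member a sink, so |𝒮| ≤ H_k(O), with equality iff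
sinks are unique (`IsKSystem.ncard_le_HkSum`).

In a simple polytope the edges at a vertex are linearly independent and every subset of them spans a
unique face, so the k-faces form a `k`-system (`IsSimplePolytope.isKSystem_kFaceVerts`); this is the
second inequality. A generic linear functional gives every face one sink, so its H_k equals f_k and
bounds every `k`-system: the first inequality. If |𝒮| = f_k, members of 𝒮 have unique sinks for all
these orientations; making the vertices of a face F lowest then forces F into 𝒮
(`IsSimplePolytope.kFaceVerts_subset`). -/

section Graph

variable {V : Type*}

/-! ### Double counting of sinks in `k`-systems -/

/-- The node set of a `k`-frame consists of a center and `k` of its neighbors. -/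
theorem IsKFrame.exists_center {G : SimpleGraph V} {k : ℕ} {H : G.Subgraph}
    (h : IsKFrame G k H) :
    ∃ (v : V) (J : Set V), J ⊆ G.neighborSet v ∧ J.ncard = k ∧ H.verts = insert v J := by
  obtain ⟨e⟩ := h
  refine ⟨(e.symm (Sum.inl 0)).1, Set.range fun i : Fin k => (e.symm (Sum.inr i)).1, ?_, ?_, ?_⟩
  · rintro _ ⟨i, rfl⟩
    have : H.coe.Adj (e.symm (Sum.inl 0)) (e.symm (Sum.inr i)) := by
      rw [e.symm.map_adj_iff]; simp
    exact H.adj_sub this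
  · rw [← Set.image_univ, Set.ncard_image_of_injective, Set.ncard_univ, Nat.card_fin]
    intro i j hij
    simpa using e.symm.injective (Subtype.ext hij)
  · ext x
    constructor
    · intro hx
      rcases hy : e ⟨x, hx⟩ with i | i
      · left
        have : e.symm (Sum.inl i) = ⟨x, hx⟩ := by rw [← hy]; simp
        rw [Subsingleton.elim (0 : Fin 1) i, this]
      · right
        exact ⟨i, by simp [← hy]⟩
    · rintro (rfl | ⟨i, rfl⟩) <;> exact Subtype.coe_prop _

/-- The star with center `v` and set of leaves `J`, as a subgraph. -/
def starSubgraph (G : SimpleGraph V) (v : V) (J : Set V) (hJ : J ⊆ G.neighborSet v) :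
    G.Subgraph where
  verts := insert v J
  Adj a b := (a = v ∧ b ∈ J) ∨ (b = v ∧ a ∈ J)
  adj_sub := by
    rintro a b (⟨rfl, h⟩ | ⟨rfl, h⟩)
    · exact hJ h
    · exact (hJ h).symm
  edge_vert := by
    rintro a b (⟨rfl, h⟩ | ⟨rfl, h⟩)
    · exact Set.mem_insert _ _
    · exact Set.mem_insert_of_mem _ h
  symm := ⟨fun _ _ h => h.symm⟩

theorem isKFrame_starSubgraph [Finite V] {G : SimpleGraph V} {k : ℕ} {v : V} {J : Set V}
    (hJ : J ⊆ G.neighborSet v) (hk : J.ncard = k) : IsKFrame G k (starSubgraph G v J hJ) := by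
  have hv : v ∉ J := fun h => G.loopless.irrefl v (hJ h)
  have e : Fin k ≃ J := (Finite.equivFinOfCardEq (by rw [← hk]; rfl)).symm
  let f : Fin 1 ⊕ Fin k → (starSubgraph G v J hJ).verts :=
    Sum.elim (fun _ => ⟨v, Set.mem_insert _ _⟩)
      (fun i => ⟨e i, Set.mem_insert_of_mem _ (e i).2⟩)
  have hf : Function.Bijective f := by
    constructor
    · rintro (i | i) (j | j) h
      · rw [Subsingleton.elim i j]
      · exact absurd (congrArg Subtype.val h) fun h' => hv (by
          have : v = (e j : V) := h'
          rw [this]; exact (e j).2)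
      · exact absurd (congrArg Subtype.val h) fun h' => hv (by
          have : (e i : V) = v := h'
          rw [← this]; exact (e i).2)
      · have : (e i : V) = e j := congrArg (fun x : (starSubgraph G v J hJ).verts => (x : V)) h
        rw [e.injective (Subtype.ext this)]
    · rintro ⟨x, rfl | hx⟩
      · exact ⟨Sum.inl 0, rfl⟩
      · exact ⟨Sum.inr (e.symm ⟨x, hx⟩), by simp [f]⟩
  have hne : ∀ i, (e i : V) ≠ v := fun i h => hv (h ▸ (e i).2)
  refine ⟨RelIso.symm ⟨Equiv.ofBijective f hf, ?_⟩⟩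
  intro a b
  change ((f a : V) = v ∧ (f b : V) ∈ J) ∨ ((f b : V) = v ∧ (f a : V) ∈ J) ↔ _
  rcases a with i | i <;> rcases b with j | j <;> simp [f, hv, hne]

theorem ncard_neighborSet_induce (G : SimpleGraph V) (S : Set V) (v : S) :
    ((G.induce S).neighborSet v).ncard = (G.neighborSet v ∩ S).ncard := by
  rw [← Set.ncard_image_of_injective _ Subtype.val_injective]
  congr 1
  ext x
  simp [and_comm]

theorem IsKSystem.existsUnique_star [Finite V] {G : SimpleGraph V} {k : ℕ} {𝒮 : Set (Set V)}
    (h𝒮 : IsKSystem G k 𝒮) {v : V} {J : Set V} (hJ : J ⊆ G.neighborSet v) (hk : J.ncard = k) :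
    ∃! S : Set V, S ∈ 𝒮 ∧ insert v J ⊆ S :=
  h𝒮.frame _ (isKFrame_starSubgraph hJ hk)

theorem IsKSystem.ncard_inter {G : SimpleGraph V} {k : ℕ} {𝒮 : Set (Set V)}
    (h𝒮 : IsKSystem G k 𝒮) {S : Set V} (hS : S ∈ 𝒮) {v : V} (hv : v ∈ S) :
    (G.neighborSet v ∩ S).ncard = k := by
  rw [← h𝒮.regular S hS ⟨v, hv⟩, ncard_neighborSet_induce]

theorem IsAcyclicOrientation.exists_isSinkOn [Finite V] {G : SimpleGraph V} {O : V → V → Prop}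
    (hO : IsAcyclicOrientation G O) {S : Set V} (hS : S.Nonempty) : ∃ v, IsSinkOn O S v := by
  have : Std.Irrefl (Relation.TransGen (fun a b => O b a)) :=
    ⟨fun a h => hO.acyclic a (Relation.transGen_swap.1 h)⟩
  obtain ⟨v, hv, h⟩ := (Finite.wellFounded_of_trans_of_irrefl
    (Relation.TransGen (fun a b => O b a))).has_min S hS
  exact ⟨v, hv, fun w hw hvw => h w hw (Relation.TransGen.single hvw)⟩

/-- In a `k`-regular induced subgraph, a sink is a node with `k` incoming edges. -/
theorem IsAcyclicOrientation.isSinkOn_iff [Finite V] {G : SimpleGraph V} {O : V → V → Prop}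
    (hO : IsAcyclicOrientation G O) {S : Set V} {v : V} {k : ℕ} (hv : v ∈ S)
    (hS : (G.neighborSet v ∩ S).ncard = k) :
    IsSinkOn O S v ↔ ({u | O u v} ∩ S).ncard = k := by
  have hsub : {u | O u v} ∩ S ⊆ G.neighborSet v ∩ S :=
    fun u hu => ⟨(hO.adj_iff v u).2 (Or.inr hu.1), hu.2⟩
  constructor
  · rintro ⟨-, h⟩
    rw [← hS]
    congr 1
    refine hsub.antisymm fun u hu => ⟨?_, hu.2⟩
    exact ((hO.adj_iff v u).1 hu.1).resolve_left (h u hu.2)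
  · intro h
    have heq := Set.eq_of_subset_of_ncard_le hsub (by rw [hS, h])
    refine ⟨hv, fun w hw hvw => ?_⟩
    have : w ∈ {u | O u v} ∩ S := heq ▸ ⟨(hO.adj_iff v w).2 (Or.inl hvw), hw⟩
    exact hO.asymm v w hvw this.1

/-- The number of members of a `k`-system in which `v` is a sink. -/
theorem IsKSystem.ncard_isSinkOn [Finite V] {G : SimpleGraph V} {k : ℕ} {𝒮 : Set (Set V)}
    (h𝒮 : IsKSystem G k 𝒮) {O : V → V → Prop} (hO : IsAcyclicOrientation G O) (v : V) :
    {S | S ∈ 𝒮 ∧ IsSinkOn O S v}.ncard = ({u | O u v}.ncard).choose k := by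
  rw [← Set.ncard_powerset_ncard (Set.toFinite _)]
  -- Bijection from members with sink v to k-sets of in-neighbours of v.
  refine Set.ncard_congr (fun S _ => {u | O u v} ∩ S) ?_ ?_ ?_
  · rintro S ⟨hS, hv⟩
    exact ⟨Set.inter_subset_left, (hO.isSinkOn_iff hv.1 (h𝒮.ncard_inter hS hv.1)).1 hv⟩
  · rintro S T ⟨hS, hvS⟩ ⟨hT, hvT⟩ h
    have hcard := (hO.isSinkOn_iff hvS.1 (h𝒮.ncard_inter hS hvS.1)).1 hvS
    have hJ : {u | O u v} ∩ S ⊆ G.neighborSet v := fun u hu => (hO.adj_iff v u).2 (Or.inr hu.1)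
    refine (h𝒮.existsUnique_star hJ hcard).unique
      ⟨hS, Set.insert_subset hvS.1 Set.inter_subset_right⟩ ⟨hT, Set.insert_subset hvT.1 ?_⟩
    exact fun u hu => (h.subset hu).2
  · rintro J ⟨hJ, hcard⟩
    obtain ⟨S, ⟨hS, hsub⟩, -⟩ := h𝒮.existsUnique_star
      (fun u hu => (hO.adj_iff v u).2 (Or.inr (hJ hu)) : J ⊆ G.neighborSet v) hcard
    obtain ⟨hv, hJS⟩ := Set.insert_subset_iff.1 hsub
    have hreg := h𝒮.ncard_inter hS hv
    -- J already accounts for all k neighbours of v in S, so no edge at v inside S points outwards.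
    have heq : J = G.neighborSet v ∩ S := Set.eq_of_subset_of_ncard_le
      (fun u hu => ⟨(hO.adj_iff v u).2 (Or.inr (hJ hu)), hJS hu⟩) (by rw [hreg, hcard])
    have hin : {u | O u v} ∩ S = J := by
      refine Set.Subset.antisymm ?_ fun u hu => ⟨hJ hu, hJS hu⟩
      rw [heq]
      exact fun u hu => ⟨(hO.adj_iff v u).2 (Or.inr hu.1), hu.2⟩
    exact ⟨S, ⟨hS, (hO.isSinkOn_iff hv hreg).2 (by rw [hin, hcard])⟩, hin⟩

/-- Groups the nodes by in-degree; the bound ensures that the sum up to d misses none. -/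
theorem HkSum_eq_sum [Fintype V] {d k : ℕ} {O : V → V → Prop}
    (hd : ∀ v, {u | O u v}.ncard ≤ d) :
    HkSum d k O = ∑ v, ({u | O u v}.ncard).choose k := by
  classical
  rw [← Finset.sum_fiberwise_of_maps_to (s := Finset.univ) (t := Finset.range (d + 1))
    (g := fun v => {u | O u v}.ncard) (fun v _ => Finset.mem_range.2 (Nat.lt_succ_of_le (hd v)))]
  refine Finset.sum_congr rfl fun i _ => ?_
  rw [Finset.sum_congr rfl (g := fun _ => i.choose k)
    (fun v hv => by rw [(Finset.mem_filter.1 hv).2]), Finset.sum_const, smul_eq_mul, hNum,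
    Set.ncard_eq_toFinset_card']
  congr 2
  ext; simp

/-- The number of members of a `k`-system is at most `H_k(O)`, with equality if and only if each
member has precisely one sink. -/
theorem IsKSystem.ncard_le_HkSum [Finite V] {G : SimpleGraph V} {d k : ℕ} {𝒮 : Set (Set V)}
    (h𝒮 : IsKSystem G k 𝒮) {O : V → V → Prop} (hO : IsAcyclicOrientation G O)
    (hd : ∀ v, (G.neighborSet v).ncard ≤ d) :
    𝒮.ncard ≤ HkSum d k O ∧ (𝒮.ncard = HkSum d k O ↔ ∀ S ∈ 𝒮, ∃! v, IsSinkOn O S v) := by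
  classical
  have := Fintype.ofFinite V
  have hin : ∀ v, {u | O u v}.ncard ≤ d := fun v =>
    (Set.ncard_le_ncard fun u hu => (hO.adj_iff v u).2 (Or.inr hu)).trans (hd v)
  have hsum : HkSum d k O =
      ∑ S ∈ 𝒮.toFinset, (Finset.univ.filter fun v => IsSinkOn O S v).card := by
    rw [HkSum_eq_sum hin]
    refine Eq.trans (Finset.sum_congr rfl fun v _ => ?_)
      (Finset.sum_card_bipartiteAbove_eq_sum_card_bipartiteBelow (s := Finset.univ)
        (t := 𝒮.toFinset) fun v S => IsSinkOn O S v)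
    rw [← h𝒮.ncard_isSinkOn hO, Set.ncard_eq_toFinset_card']
    congr 1
    ext S
    simp [Finset.bipartiteAbove]
  have hpos : ∀ S ∈ 𝒮.toFinset, 1 ≤ (Finset.univ.filter fun v => IsSinkOn O S v).card := by
    intro S hS
    obtain ⟨v, hv⟩ := hO.exists_isSinkOn (h𝒮.nonempty S (Set.mem_toFinset.1 hS))
    exact Finset.card_pos.2 ⟨v, by simpa using hv⟩
  have hcard : 𝒮.ncard = ∑ S ∈ 𝒮.toFinset, 1 := by
    rw [Finset.sum_const, smul_eq_mul, mul_one, Set.ncard_eq_toFinset_card']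
  rw [hsum, hcard]
  refine ⟨Finset.sum_le_sum hpos, ?_⟩
  rw [Finset.sum_eq_sum_iff_of_le hpos]
  simp only [Set.mem_toFinset]
  refine forall₂_congr fun S hS => ?_
  rw [eq_comm, Finset.card_eq_one_iff_existsUnique]
  simp

end Graph

/-! ### Cones spanned by the edges at a vertex -/

section Polytope

variable {E : Type*} [NormedAddCommGroup E] [NormedSpace ℝ E]

/-- A face of a finitely generated cone is generated by the generators that lie in it. -/
theorem PointedCone.mem_hull_of_nonpos {T : Set E} {φ : E → ℝ} (hadd : ∀ x y, φ (x + y) = φ x + φ y)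
    (hsmul : ∀ (c : ℝ) x, φ (c • x) = c * φ x) (hT : ∀ t ∈ T, φ t ≤ 0) {y : E}
    (hy : y ∈ PointedCone.hull ℝ T) :
    φ y ≤ 0 ∧ (φ y = 0 → y ∈ PointedCone.hull ℝ {t ∈ T | φ t = 0}) := by
  induction hy using Submodule.span_induction with
  | mem t ht => exact ⟨hT t ht, fun h => Submodule.subset_span ⟨ht, h⟩⟩
  | zero => exact ⟨by have := hsmul 0 0; simp_all, fun _ => zero_mem _⟩
  | add a b _ _ iha ihb =>
    rw [hadd]
    -- Two nonpositive numbers with sum zero both vanish.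
    exact ⟨add_nonpos iha.1 ihb.1, fun h => add_mem (iha.2 (by linarith [iha.1, ihb.1]))
      (ihb.2 (by linarith [iha.1, ihb.1]))⟩
  | smul c a _ iha =>
    have hc : c • a = (c : ℝ) • a := rfl
    rw [hc, hsmul]
    refine ⟨mul_nonpos_of_nonneg_of_nonpos c.2 iha.1, fun h => ?_⟩
    rcases mul_eq_zero.1 h with h | h
    · rw [h, zero_smul]; exact zero_mem _
    · exact PointedCone.smul_mem _ c.2 (iha.2 h)

theorem sub_mem_hull_of_mem_convexHull {s : Set E} {v x : E} (hx : x ∈ convexHull ℝ s) :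
    x - v ∈ PointedCone.hull ℝ ((fun u => u - v) '' (s \ {v})) := by
  set C := PointedCone.hull ℝ ((fun u => u - v) '' (s \ {v}))
  have hconv : Convex ℝ ((fun u => u + -v) ⁻¹' (C : Set E)) := C.convex.translate_preimage_left (-v)
  rw [sub_eq_add_neg]
  refine convexHull_min (fun u hu => ?_) hconv hx
  change u + -v ∈ C
  rw [← sub_eq_add_neg]
  by_cases h : u = v
  · rw [h, sub_self]; exact zero_mem _
  · exact Submodule.subset_span ⟨u, ⟨hu, h⟩, rfl⟩

/-- Extreme points of polytopes are strictly exposed. -/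
theorem exists_forall_lt_of_mem_extremePoints {s : Set E} (hs : s.Finite) {x : E}
    (hx : x ∈ (convexHull ℝ s).extremePoints ℝ) :
    ∃ l : E →L[ℝ] ℝ, ∀ y ∈ convexHull ℝ s, y ≠ x → l y < l x := by
  have hx' := ((convex_convexHull ℝ s).mem_extremePoints_iff_mem_sdiff_convexHull_sdiff.1 hx).2
  have hsub : x ∉ convexHull ℝ (s \ {x}) := fun h =>
    hx' (convexHull_mono (Set.sdiff_subset_sdiff_left (subset_convexHull ℝ s)) h)
  -- Separating x from the hull of the other generators makes l negative on every generator of the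
  -- cone at x, so l vanishes on that cone only at 0.
  obtain ⟨l, c, hl, hc⟩ := geometric_hahn_banach_closed_point (convex_convexHull ℝ (s \ {x}))
    ((hs.subset Set.sdiff_subset).isClosed_convexHull (𝕜 := ℝ)) hsub
  have hneg : ∀ t ∈ (fun u => u - x) '' (s \ {x}), l t < 0 := by
    rintro _ ⟨u, hu, rfl⟩
    rw [map_sub]
    linarith [hl u (subset_convexHull ℝ _ hu)]
  refine ⟨l, fun y hy hyx => ?_⟩
  have := PointedCone.mem_hull_of_nonpos (φ := l) (map_add l) (fun c z => by simp)
    (fun t ht => (hneg t ht).le) (sub_mem_hull_of_mem_convexHull (v := x) hy)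
  rw [map_sub] at this
  refine lt_of_le_of_ne (by linarith [this.1]) fun h => hyx ?_
  have h0 := this.2 (by linarith)
  have hempty : {t ∈ (fun u => u - x) '' (s \ {x}) | l t = 0} = ∅ := by
    ext t
    simpa using fun u hu hux h => (hneg t ⟨u, ⟨hu, hux⟩, h⟩).ne
  rw [hempty] at h0
  exact sub_eq_zero.1 (by simpa using h0)

theorem IsPolytope.isCompact {P : Set E} (hP : IsPolytope P) : IsCompact P := by
  obtain ⟨s, hs, rfl⟩ := hP
  exact hs.isCompact_convexHull (𝕜 := ℝ)

theorem IsPolytope.convex {P : Set E} (hP : IsPolytope P) : Convex ℝ P := by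
  obtain ⟨s, hs, rfl⟩ := hP
  exact convex_convexHull ℝ s

theorem polyDim_singleton (v : E) : polyDim ({v} : Set E) = 0 := by
  simp [polyDim]

theorem isKFace_singleton_of_forall_lt {P : Set E} {v : E} (hv : v ∈ P) {l : E →L[ℝ] ℝ}
    (hl : ∀ y ∈ P, y ≠ v → l y < l v) : IsKFace P 0 {v} := by
  refine ⟨Set.singleton_nonempty v, fun _ => ⟨l, ?_⟩, polyDim_singleton v⟩
  ext y
  constructor
  · rintro rfl
    exact ⟨hv, fun z hz => by
      by_cases h : z = y
      · rw [h]
      · exact (hl z hz h).le⟩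
  · rintro ⟨hy, h⟩
    by_contra hne
    exact (hl y hy hne).not_ge (h v hv)

/-- Exposed points are always extreme; the converse relies on finite generation. -/
theorem IsPolytope.mem_polyVertices_iff {P : Set E} (hP : IsPolytope P) {v : E} :
    v ∈ polyVertices P ↔ v ∈ P.extremePoints ℝ := by
  constructor
  · intro hv
    have h : IsExposed ℝ P {v} := hv.exposed
    exact isExtreme_singleton.1 h.isExtreme
  · intro hv
    obtain ⟨s, hs, rfl⟩ := hP
    obtain ⟨l, hl⟩ := exists_forall_lt_of_mem_extremePoints hs hv
    exact isKFace_singleton_of_forall_lt hv.1 hl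

/-- The vectors along the edges of `P` at `v` into nodes in `W`. -/
def edgeVectors (P : Set E) (v : polyVertices P) (W : Set (polyVertices P)) : Set E :=
  (fun w : polyVertices P => (w : E) - v) '' ((polyGraph P).neighborSet v ∩ W)

/-- An exposed face that lies on a ray from the vertex `v` is an edge at `v`. -/
theorem IsPolytope.exists_adj_of_face_subset_ray {P : Set E} (hP : IsPolytope P)
    {v : polyVertices P} {l : E →L[ℝ] ℝ} {F : Set E} (hF : IsExposed ℝ P F) (hvF : (v : E) ∈ F)
    {q : E} (hlq : l q < 0) (hray : ∀ x ∈ F, ∃ c : ℝ, 0 ≤ c ∧ x = v + c • q) {u : E} (hu : u ∈ F)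
    (huv : u ≠ v) :
    ∃ w : polyVertices P, (polyGraph P).Adj v w ∧ ∃ c : ℝ, 0 ≤ c ∧ q = c • ((w : E) - v) := by
  have hcomp : IsCompact F := hF.isCompact hP.isCompact
  -- Since l decreases along q, its minimizer on F is the far end of the edge.
  obtain ⟨w, hwF, hw⟩ := hcomp.exists_isMinOn ⟨u, hu⟩ l.continuous.continuousOn
  obtain ⟨c₀, hc₀, rfl⟩ := hray w hwF
  have hle : ∀ c : ℝ, (v : E) + c • q ∈ F → c ≤ c₀ := by
    intro c hc
    have : l (v + c₀ • q) ≤ l (v + c • q) := hw hc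
    simp only [map_add, map_smul, smul_eq_mul] at this
    nlinarith
  have hpos : 0 < c₀ := by
    obtain ⟨c, hc, rfl⟩ := hray u hu
    refine lt_of_lt_of_le (lt_of_le_of_ne hc fun h => huv ?_) (hle c hu)
    rw [← h, zero_smul, add_zero]
  have hvert : (v : E) + c₀ • q ∈ polyVertices P := by
    rw [hP.mem_polyVertices_iff, ← isExtreme_singleton]
    refine hF.isExtreme.trans (IsExposed.isExtreme (𝕜 := ℝ) fun _ => ⟨-l, ?_⟩)
    ext x
    constructor
    · rintro rfl
      exact ⟨hwF, fun y hy => neg_le_neg (hw hy)⟩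
    · rintro ⟨hx, h⟩
      obtain ⟨c, hc, rfl⟩ := hray x hx
      have h1 := h _ hwF
      simp only [neg_apply, map_add, map_smul, smul_eq_mul] at h1
      have : c = c₀ := le_antisymm (hle c hx) (by nlinarith)
      rw [this]; rfl
  have hq : q ≠ 0 := by rintro rfl; simp at hlq
  have hseg : segment ℝ (v : E) (v + c₀ • q) = F := by
    refine ((hF.convex hP.convex).segment_subset hvF hwF).antisymm fun x hx => ?_
    obtain ⟨c, hc, rfl⟩ := hray x hx
    rw [segment_eq_image']
    refine ⟨c / c₀, ⟨by positivity, (div_le_one hpos).2 (hle c hx)⟩, ?_⟩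
    simp only [add_sub_cancel_left, smul_smul]
    rw [div_mul_cancel₀ _ hpos.ne']
  refine ⟨⟨_, hvert⟩, ⟨fun h => ?_, ?_⟩, c₀⁻¹, by positivity, ?_⟩
  · have := congrArg Subtype.val h
    simp [hq, hpos.ne'] at this
  · simp only
    refine ⟨⟨v, left_mem_segment ..⟩, by rw [hseg]; exact hF, ?_⟩
    rw [polyDim, vectorSpan_segment, vsub_eq_sub, add_sub_cancel_left]
    exact finrank_span_singleton (smul_ne_zero hpos.ne' hq)
  · simp [smul_smul, hpos.ne']

/-- A polytope lies in the cone spanned at a vertex by the edges at this vertex. -/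
theorem IsPolytope.sub_mem_hull_edgeVectors {P : Set E} (hP : IsPolytope P) (v : polyVertices P)
    {x : E} (hx : x ∈ P) : x - v ∈ PointedCone.hull ℝ (edgeVectors P v Set.univ) := by
  have hvext := hP.mem_polyVertices_iff.1 v.2
  obtain ⟨s, hs, rfl⟩ := id hP
  obtain ⟨l, hl⟩ := exists_forall_lt_of_mem_extremePoints hs hvext
  -- Vertex figure: the directions from v to the other generators, rescaled onto the hyperplane l =
  -- -1.
  set T : Set E := (fun u => (l v - l u)⁻¹ • (u - (v : E))) '' (s \ {(v : E)}) with hTdef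
  have hlpos : ∀ u ∈ s \ {(v : E)}, 0 < l v - l u := fun u hu =>
    sub_pos.2 (hl u (subset_convexHull ℝ s hu.1) hu.2)
  have hTfin : T.Finite := (hs.subset Set.sdiff_subset).image _
  have hlT : ∀ t ∈ T, l t = -1 := by
    rintro _ ⟨u, hu, rfl⟩
    have := hlpos u hu
    rw [map_smul, map_sub, smul_eq_mul]
    field_simp
    ring
  have hPT : ∀ y ∈ convexHull ℝ s, y - v ∈ PointedCone.hull ℝ T := by
    intro y hy
    refine Submodule.span_le.2 ?_ (sub_mem_hull_of_mem_convexHull (v := (v : E)) hy)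
    rintro _ ⟨u, hu, rfl⟩
    have hp := hlpos u hu
    have : u - (v : E) = (l v - l u) • ((l v - l u)⁻¹ • (u - (v : E))) := by
      rw [smul_smul, mul_inv_cancel₀ hp.ne', one_smul]
    change u - (v : E) ∈ PointedCone.hull ℝ T
    rw [this]
    exact PointedCone.smul_mem _ hp.le (Submodule.subset_span ⟨u, hu, rfl⟩)
  -- By Krein–Milman only the extreme points q of the vertex figure matter; each is shown to point
  -- along an edge.
  have hQ : T ⊆ convexHull ℝ ((convexHull ℝ T).extremePoints ℝ) := by
    have hfin : ((convexHull ℝ T).extremePoints ℝ).Finite :=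
      hTfin.subset extremePoints_convexHull_subset
    rw [← (hfin.isClosed_convexHull (𝕜 := ℝ)).closure_eq,
      closure_convexHull_extremePoints (hTfin.isCompact_convexHull (𝕜 := ℝ)) (convex_convexHull ℝ T)]
    exact subset_convexHull ℝ T
  refine Submodule.span_le.2 ?_ (hPT x hx)
  refine hQ.trans (convexHull_min ?_ (PointedCone.convex _))
  intro q hq
  obtain ⟨m, hm⟩ := exists_forall_lt_of_mem_extremePoints hTfin hq
  have hqT : q ∈ T := extremePoints_convexHull_subset hq
  -- Homogenizes m - m q: the two agree where l = -1. Hence φ ≤ 0 on the cone, and it vanishes only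
  -- on the ray through q.
  set φ : E →L[ℝ] ℝ := m + m q • l with hφ
  have hφT : ∀ t ∈ T, φ t = m t - m q := by
    intro t ht
    simp [hφ, hlT t ht, sub_eq_add_neg]
  have hφT' : ∀ t ∈ T, φ t ≤ 0 := by
    intro t ht
    rw [hφT t ht, sub_nonpos]
    by_cases h : t = q
    · rw [h]
    · exact (hm t (subset_convexHull ℝ T ht) h).le
  have hcone := fun y (hy : y ∈ convexHull ℝ s) => PointedCone.mem_hull_of_nonpos (φ := φ)
    (map_add φ) (fun c z => by simp) hφT' (hPT y hy)
  have hzero : {t ∈ T | φ t = 0} = {q} := by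
    ext t
    constructor
    · rintro ⟨ht, h⟩
      by_contra hne
      rw [hφT t ht] at h
      exact (hm t (subset_convexHull ℝ T ht) hne).ne (by linarith)
    · rintro rfl
      exact ⟨hqT, by rw [hφT _ hqT, sub_self]⟩
  have hvP : (v : E) ∈ convexHull ℝ s := hvext.1
  set F : Set E := {y ∈ convexHull ℝ s | ∀ z ∈ convexHull ℝ s, φ z ≤ φ y} with hFdef
  have hvF : (v : E) ∈ F := ⟨hvP, fun z hz => by
    have := (hcone z hz).1
    rw [map_sub] at this
    linarith⟩
  obtain ⟨u, hu, huq⟩ := id hqT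
  have hup := hlpos u hu
  have hus : u ∈ convexHull ℝ s := subset_convexHull ℝ s hu.1
  have huF : u ∈ F := by
    refine ⟨hus, fun z hz => (hvF.2 z hz).trans ?_⟩
    have h0 : φ q = 0 := by rw [hφT q hqT, sub_self]
    rw [← huq, map_smul, map_sub, smul_eq_mul, mul_eq_zero] at h0
    rcases h0 with h0 | h0
    · exact absurd h0 (inv_ne_zero hup.ne')
    · linarith
  obtain ⟨w, hw, c, hc, hqc⟩ := hP.exists_adj_of_face_subset_ray (v := v) (l := l) (F := F) (q := q)
    (fun _ => ⟨φ, rfl⟩) hvF (by rw [hlT q hqT]; norm_num) (fun y hy => by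
      have h0 := (hcone y hy.1).2 (by
        rw [map_sub, sub_eq_zero]
        exact le_antisymm (hvF.2 y hy.1) (hy.2 v hvP))
      rw [hzero, Submodule.mem_span_singleton] at h0
      obtain ⟨c, hc⟩ := h0
      exact ⟨c, c.2, by
        have : (c : ℝ) • q = y - v := hc
        rw [this, add_sub_cancel]⟩) huF hu.2
  rw [SetLike.mem_coe, hqc]
  exact PointedCone.smul_mem _ hc (Submodule.subset_span ⟨w, ⟨hw, trivial⟩, rfl⟩)

/-- A face lies in the cone spanned at a vertex by the edges of the face at this vertex. -/
theorem IsPolytope.sub_mem_hull_edgeVectors_face {P F : Set E} (hP : IsPolytope P)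
    (hF : IsExposed ℝ P F) {v : polyVertices P} (hv : v ∈ faceVerts P F) {x : E} (hx : x ∈ F) :
    x - v ∈ PointedCone.hull ℝ (edgeVectors P v (faceVerts P F)) := by
  obtain ⟨l, hl⟩ := hF ⟨x, hx⟩
  have hvF : (v : E) ∈ {x ∈ P | ∀ y ∈ P, l y ≤ l x} := hl ▸ hv
  have hxF : x ∈ {x ∈ P | ∀ y ∈ P, l y ≤ l x} := hl ▸ hx
  have hP' : ∀ w : polyVertices P, (w : E) ∈ P := fun w => (hP.mem_polyVertices_iff.1 w.2).1
  have h := (PointedCone.mem_hull_of_nonpos (φ := l) (map_add l) (fun c z => by simp) (by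
    rintro _ ⟨w, -, rfl⟩
    rw [map_sub]
    -- The functional exposing F is nonpositive on edges at v and zero on x - v, so only edges on
    -- which it vanishes contribute.
    linarith [hvF.2 w (hP' w)]) (hP.sub_mem_hull_edgeVectors v hxF.1)).2 (by
      rw [map_sub, sub_eq_zero]
      exact le_antisymm (hvF.2 x hxF.1) (hxF.2 v hvF.1))
  refine Submodule.span_mono ?_ h
  rintro _ ⟨⟨w, hw, rfl⟩, h0⟩
  refine ⟨w, ⟨hw.1, ?_⟩, rfl⟩
  have h0 : l w = l v := by
    rw [map_sub] at h0
    linarith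
  change (w : E) ∈ F
  rw [hl]
  exact ⟨hP' w, fun y hy => by rw [h0]; exact hvF.2 y hy⟩

end Polytope

section Polytope

variable {E : Type*} [NormedAddCommGroup E] [NormedSpace ℝ E]

theorem IsPolytope.coe_mem {P : Set E} (hP : IsPolytope P) (v : polyVertices P) : (v : E) ∈ P :=
  (hP.mem_polyVertices_iff.1 v.2).1

theorem IsPolytope.vectorSpan_face {P F : Set E} (hP : IsPolytope P) (hF : IsExposed ℝ P F)
    {v : polyVertices P} (hv : v ∈ faceVerts P F) :
    vectorSpan ℝ F = Submodule.span ℝ (edgeVectors P v (faceVerts P F)) := by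
  rw [vectorSpan_eq_span_vsub_set_right ℝ (show (v : E) ∈ F from hv)]
  apply le_antisymm <;> rw [Submodule.span_le]
  · rintro _ ⟨x, hx, rfl⟩
    exact PointedCone.hull_le_span ℝ _ (hP.sub_mem_hull_edgeVectors_face hF hv hx)
  · rintro _ ⟨w, hw, rfl⟩
    exact Submodule.subset_span ⟨w, hw.2, rfl⟩

theorem IsPolytope.exists_mem_faceVerts {P F : Set E} (hP : IsPolytope P) (hF : IsExposed ℝ P F)
    (hne : F.Nonempty) : (faceVerts P F).Nonempty := by
  obtain ⟨x, hx⟩ := (hF.isCompact hP.isCompact).extremePoints_nonempty hne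
  exact ⟨⟨x, hP.mem_polyVertices_iff.2 (hF.isExtreme.extremePoints_subset_extremePoints hx)⟩, hx.1⟩

/-- Faces that share a vertex are ordered by their edges at this vertex. -/
theorem IsPolytope.face_subset_face {P F F' : Set E} (hP : IsPolytope P) (hF : IsExposed ℝ P F)
    (hF' : IsExposed ℝ P F') {v : polyVertices P} (hv : v ∈ faceVerts P F)
    (hv' : v ∈ faceVerts P F')
    (h : (polyGraph P).neighborSet v ∩ faceVerts P F ⊆ faceVerts P F') : F ⊆ F' := by
  intro x hx
  obtain ⟨l, hl⟩ := hF' ⟨v, hv'⟩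
  have hvF : (v : E) ∈ {x ∈ P | ∀ y ∈ P, l y ≤ l x} := hl ▸ hv'
  have hle : edgeVectors P v (faceVerts P F) ⊆ LinearMap.ker (l : E →ₗ[ℝ] ℝ) := by
    rintro _ ⟨w, hw, rfl⟩
    have hwF : (w : E) ∈ {x ∈ P | ∀ y ∈ P, l y ≤ l x} := hl ▸ h hw
    have : l w = l v := le_antisymm (hvF.2 w hwF.1) (hwF.2 v hvF.1)
    simp [this]
  have hx0 := Submodule.span_le.2 hle
    (PointedCone.hull_le_span ℝ _ (hP.sub_mem_hull_edgeVectors_face hF hv hx))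
  have hx0 : l x = l v := by
    have : l (x - v) = 0 := hx0
    rw [map_sub] at this
    linarith
  rw [hl]
  exact ⟨hF.subset hx, fun y hy => by rw [hx0]; exact hvF.2 y hy⟩

/-- A vertex of a face that maximizes `l` among its neighbors in the face maximizes `l`
over the face. -/
theorem IsPolytope.le_of_forall_adj_le {P F : Set E} (hP : IsPolytope P) (hF : IsExposed ℝ P F)
    {v : polyVertices P} (hv : v ∈ faceVerts P F) {l : E →L[ℝ] ℝ}
    (hl : ∀ w ∈ faceVerts P F, (polyGraph P).Adj v w → l w ≤ l v) {x : E} (hx : x ∈ F) :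
    l x ≤ l v := by
  have := (PointedCone.mem_hull_of_nonpos (φ := l) (map_add l) (fun c z => by simp) (by
    rintro _ ⟨w, hw, rfl⟩
    rw [map_sub]
    linarith [hl w hw.2 hw.1]) (hP.sub_mem_hull_edgeVectors_face hF hv hx)).1
  rw [map_sub] at this
  linarith

/-! ### Faces of simple polytopes -/

/-- At a vertex of a simple polytope the edges are linearly independent. -/
theorem IsSimplePolytope.linearIndepOn {P : Set E} {d : ℕ} (hP : IsSimplePolytope P d)
    (v : polyVertices P) :
    LinearIndepOn ℝ (fun w : polyVertices P => (w : E) - v) ((polyGraph P).neighborSet v) := by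
  have := hP.polytope.finite_polyVertices.to_subtype
  have := Fintype.ofFinite ((polyGraph P).neighborSet v)
  refine linearIndependent_iff_card_eq_finrank_span.2 ?_
  -- With P as its own face, the d edge vectors span a space of dimension d.
  have h := hP.polytope.vectorSpan_face (IsExposed.refl P) (v := v) (hP.polytope.coe_mem v)
  have huniv : faceVerts P P = Set.univ := Set.eq_univ_of_forall hP.polytope.coe_mem
  rw [huniv, edgeVectors, Set.inter_univ] at h
  have hd := hP.dim_eq
  rw [polyDim, h, ← hP.degree_eq v, Set.ncard_eq_toFinset_card', Set.toFinset_card] at hd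
  rw [← hd, Set.finrank, Set.image_eq_range]

theorem IsSimplePolytope.polyDim_face {P F : Set E} {d : ℕ} (hP : IsSimplePolytope P d)
    (hF : IsExposed ℝ P F) {v : polyVertices P} (hv : v ∈ faceVerts P F) :
    polyDim F = ((polyGraph P).neighborSet v ∩ faceVerts P F).ncard := by
  have := hP.polytope.finite_polyVertices.to_subtype
  have := Fintype.ofFinite ↥((polyGraph P).neighborSet v ∩ faceVerts P F)
  have h := finrank_span_eq_card ((hP.linearIndepOn v).mono
    (Set.inter_subset_left (t := faceVerts P F)))
  rw [polyDim, hP.polytope.vectorSpan_face hF hv, edgeVectors, Set.image_eq_range, h,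
    Set.ncard_eq_toFinset_card', Set.toFinset_card]

/-- At a vertex of a simple polytope, every set of edges spans a face. -/
theorem IsSimplePolytope.exists_face [FiniteDimensional ℝ E] {P : Set E} {d : ℕ}
    (hP : IsSimplePolytope P d) (v : polyVertices P) {J : Set (polyVertices P)}
    (hJ : J ⊆ (polyGraph P).neighborSet v) :
    ∃ F, IsExposed ℝ P F ∧ v ∈ faceVerts P F ∧
      (polyGraph P).neighborSet v ∩ faceVerts P F = J := by
  classical
  let b := Module.Basis.span (hP.linearIndepOn v)
  -- Independence allows prescribing 0 on the edges in J and -1 on the others; the maximizers of f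
  -- form the face.
  obtain ⟨f, hf⟩ := LinearMap.exists_extend
    (b.constr ℝ fun w => if (w : polyVertices P) ∈ J then (0 : ℝ) else -1)
  have hfw : ∀ w ∈ (polyGraph P).neighborSet v, f ((w : E) - v) = if w ∈ J then (0 : ℝ) else -1 := by
    intro w hw
    have h := LinearMap.congr_fun hf (b ⟨w, hw⟩)
    rw [b.constr_basis] at h
    rw [← h, LinearMap.comp_apply, Submodule.subtype_apply]
    exact congrArg (fun z => f (Subtype.val z))
      (Module.Basis.span_apply (hP.linearIndepOn v) ⟨w, hw⟩).symm
  have hmax : ∀ x ∈ P, f x ≤ f v := by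
    intro x hx
    have := (PointedCone.mem_hull_of_nonpos (φ := f) (map_add f) (fun c z => by simp) (by
      rintro _ ⟨w, hw, rfl⟩
      rw [hfw w hw.1]
      split_ifs <;> norm_num) (hP.polytope.sub_mem_hull_edgeVectors v hx)).1
    rw [map_sub] at this
    linarith
  have hvP := hP.polytope.coe_mem v
  refine ⟨{x ∈ P | ∀ y ∈ P, f y ≤ f x}, fun _ => ⟨LinearMap.toContinuousLinearMap f, rfl⟩,
    ⟨hvP, hmax⟩, ?_⟩
  ext w
  constructor
  · rintro ⟨hw, hwF⟩
    by_contra hwJ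
    have := hfw w hw
    rw [if_neg hwJ, map_sub] at this
    linarith [hwF.2 v hvP]
  · intro hw
    have := hfw w (hJ hw)
    rw [if_pos hw, map_sub] at this
    exact ⟨hJ hw, hP.polytope.coe_mem w, fun y hy => by linarith [hmax y hy]⟩

theorem IsSimplePolytope.ncard_inter_face {P F : Set E} {d k : ℕ} (hP : IsSimplePolytope P d)
    (hF : IsKFace P k F) {v : polyVertices P} (hv : v ∈ faceVerts P F) :
    ((polyGraph P).neighborSet v ∩ faceVerts P F).ncard = k := by
  rw [← hP.polyDim_face hF.exposed hv, hF.dim_eq]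

/-- The vertex sets of the `k`-faces of a simple polytope form a `k`-system. -/
theorem IsSimplePolytope.isKSystem_kFaceVerts [FiniteDimensional ℝ E] {P : Set E} {d k : ℕ}
    (hP : IsSimplePolytope P d) : IsKSystem (polyGraph P) k (kFaceVerts P k) := by
  have := hP.polytope.finite_polyVertices.to_subtype
  refine ⟨?_, ?_, ?_⟩
  · rintro _ ⟨F, hF, rfl⟩
    exact hP.polytope.exists_mem_faceVerts hF.exposed hF.nonempty
  · rintro _ ⟨F, hF, rfl⟩ v
    rw [ncard_neighborSet_induce, hP.ncard_inter_face hF v.2]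
  · intro H hH
    obtain ⟨v, J, hJ, hcard, hverts⟩ := hH.exists_center
    rw [hverts]
    obtain ⟨F, hF, hv, hFJ⟩ := hP.exists_face v hJ
    have hkF : IsKFace P k F := ⟨⟨v, hv⟩, hF, by rw [hP.polyDim_face hF hv, hFJ, hcard]⟩
    refine ⟨faceVerts P F, ⟨⟨F, hkF, rfl⟩, Set.insert_subset hv ?_⟩, ?_⟩
    · rw [← hFJ]
      exact Set.inter_subset_right
    · rintro _ ⟨⟨F', hF', rfl⟩, hsub⟩
      obtain ⟨hv', hJ'⟩ := Set.insert_subset_iff.1 hsub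
      have hFJ' : J = (polyGraph P).neighborSet v ∩ faceVerts P F' :=
        Set.eq_of_subset_of_ncard_le (Set.subset_inter hJ hJ')
          (by rw [hP.ncard_inter_face hF' hv', hcard])
      congr 1
      apply Set.Subset.antisymm
      · refine hP.polytope.face_subset_face hF'.exposed hF hv' hv ?_
        rw [← hFJ', ← hFJ]
        exact Set.inter_subset_right
      · refine hP.polytope.face_subset_face hF hF'.exposed hv hv' ?_
        rw [hFJ]
        exact hJ'

/-! ### Orientations given by linear functionals -/

/-- Every linear functional can be perturbed to one that is injective on a given finite set
without changing its strict inequalities on that set. -/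
theorem exists_injOn_forall_lt [FiniteDimensional ℝ E] {V : Set E} (hV : V.Finite)
    (a : E →L[ℝ] ℝ) :
    ∃ l : E →L[ℝ] ℝ, Set.InjOn l V ∧ ∀ u ∈ V, ∀ v ∈ V, a u < a v → l u < l v := by
  have := hV.to_subtype
  -- g separates the points of V; a + ε g with small ε > 0 keeps the strict inequalities of a and
  -- lets g break its ties.
  obtain ⟨g, hg⟩ := Module.exists_dual_forall_apply_ne_zero (K := ℝ)
    (fun p : {p : V × V // (p.1 : E) ≠ p.2} => (p.1.1 : E) - p.1.2) fun p => sub_ne_zero.2 p.2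
  have hev : ∀ᶠ ε : ℝ in nhdsWithin 0 (Set.Ioi 0), ∀ p : V × V, a p.1 < a p.2 →
      a p.1 + ε * g p.1 < a p.2 + ε * g p.2 := by
    refine Filter.eventually_all.2 fun p => ?_
    by_cases h : a p.1 < a p.2
    · have hc : Continuous fun ε : ℝ => a p.2 + ε * g p.2 - (a p.1 + ε * g p.1) := by fun_prop
      have := hc.continuousAt.eventually_const_lt
        (show 0 < a p.2 + 0 * g p.2 - (a p.1 + 0 * g p.1) by
        simpa using h)
      filter_upwards [nhdsWithin_le_nhds this] with ε hε _
      linarith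
    · exact Filter.Eventually.of_forall fun ε h' => absurd h' h
  obtain ⟨ε, hε, hpos⟩ := (hev.and self_mem_nhdsWithin).exists
  have hlt : ∀ u ∈ V, ∀ v ∈ V, a u < a v → a u + ε * g u < a v + ε * g v :=
    fun u hu v hv => hε (⟨u, hu⟩, ⟨v, hv⟩)
  refine ⟨a + ε • LinearMap.toContinuousLinearMap g, fun u hu v hv h => ?_, hlt⟩
  have h : a u + ε * g u = a v + ε * g v := h
  by_contra hne
  rcases lt_trichotomy (a u) (a v) with h' | h' | h'
  · exact (hlt u hu v hv h').ne h
  · rw [h', add_right_inj] at h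
    refine hg ⟨(⟨u, hu⟩, ⟨v, hv⟩), hne⟩ ?_
    rw [map_sub, mul_left_cancel₀ (ne_of_gt hpos) h, sub_self]
  · exact (hlt v hv u hu h').ne h.symm

/-- The orientation of the graph of `P` in which `l` increases along the edges. -/
def functionalOrientation (P : Set E) (l : E →L[ℝ] ℝ) (u v : polyVertices P) : Prop :=
  (polyGraph P).Adj u v ∧ l u < l v

theorem isAcyclicOrientation_functionalOrientation {P : Set E} {l : E →L[ℝ] ℝ}
    (hl : Set.InjOn l (polyVertices P)) :
    IsAcyclicOrientation (polyGraph P) (functionalOrientation P l) := by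
  refine ⟨fun u v => ⟨fun h => ?_, ?_⟩, fun u v h h' => h.2.not_gt h'.2, fun v h => ?_⟩
  · rcases lt_trichotomy (l u) (l v) with h' | h' | h'
    · exact Or.inl ⟨h, h'⟩
    · exact absurd (Subtype.ext (hl u.2 v.2 h')) h.ne
    · exact Or.inr ⟨h.symm, h'⟩
  · rintro (h | h)
    exacts [h.1, h.1.symm]
  · have : ∀ w, Relation.TransGen (functionalOrientation P l) v w → l v < l w := by
      intro w hw
      induction hw with
      | single h => exact h.2
      | tail _ h ih => exact ih.trans h.2
    exact (this v h).false

/-- A sink is a local maximum of l, hence a global one on the face; injectivity allows only one. -/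
theorem IsPolytope.existsUnique_isSinkOn {P F : Set E} (hP : IsPolytope P)
    (hF : IsExposed ℝ P F) (hne : F.Nonempty) {l : E →L[ℝ] ℝ}
    (hl : Set.InjOn l (polyVertices P)) :
    ∃! v, IsSinkOn (functionalOrientation P l) (faceVerts P F) v := by
  have := hP.finite_polyVertices.to_subtype
  have hmax : ∀ v, IsSinkOn (functionalOrientation P l) (faceVerts P F) v →
      ∀ x ∈ F, l x ≤ l v := fun v hv x hx =>
    hP.le_of_forall_adj_le hF hv.1 (fun w hw h => not_lt.1 fun h' => hv.2 w hw ⟨h, h'⟩) hx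
  obtain ⟨v, hv⟩ := (isAcyclicOrientation_functionalOrientation hl).exists_isSinkOn
    (hP.exists_mem_faceVerts hF hne)
  exact ⟨v, hv, fun w hw => Subtype.ext (hl w.2 v.2
    (le_antisymm (hmax v hv w hw.1) (hmax w hw v hv.1)))⟩

/-- If every member of a `k`-system has a unique sink for each orientation given by a linear
functional, then the `k`-system contains the vertex sets of all `k`-faces. -/
theorem IsSimplePolytope.kFaceVerts_subset [FiniteDimensional ℝ E] {P : Set E} {d k : ℕ}
    (hP : IsSimplePolytope P d) {𝒮 : Set (Set (polyVertices P))}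
    (h𝒮 : IsKSystem (polyGraph P) k 𝒮)
    (huniq : ∀ l : E →L[ℝ] ℝ, Set.InjOn l (polyVertices P) →
      ∀ S ∈ 𝒮, ∃! v, IsSinkOn (functionalOrientation P l) S v) :
    kFaceVerts P k ⊆ 𝒮 := by
  have hfin := hP.polytope.finite_polyVertices
  have := hfin.to_subtype
  rintro _ ⟨F, hF, rfl⟩
  obtain ⟨a, ha⟩ := hF.exposed hF.nonempty
  -- F maximizes a, so perturbing -a places the vertices of F below all others.
  obtain ⟨l, hinj, hlt⟩ := exists_injOn_forall_lt hfin (-a)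
  have hinitial : ∀ u ∈ faceVerts P F, ∀ w ∉ faceVerts P F, l u < l w := by
    intro u hu w hw
    refine hlt u u.2 w w.2 (neg_lt_neg ?_)
    have hu' : (u : E) ∈ {x ∈ P | ∀ y ∈ P, a y ≤ a x} := ha ▸ hu
    refine lt_of_le_of_ne (hu'.2 w (hP.polytope.coe_mem w)) fun h => hw ?_
    change (w : E) ∈ F
    rw [ha]
    have h : a w = a u := h
    exact ⟨hP.polytope.coe_mem w, by rw [h]; exact hu'.2⟩
  have hO := isAcyclicOrientation_functionalOrientation hinj
  obtain ⟨v, hv, hvuniq⟩ := hP.polytope.existsUnique_isSinkOn hF.exposed hF.nonempty hinj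
  -- S contains the frame of F at its sink v; by regularity v has the same neighbours in S as in F,
  -- so v is a sink of S too.
  obtain ⟨S, ⟨hS, hsub⟩, -⟩ := h𝒮.existsUnique_star Set.inter_subset_left
    (hP.ncard_inter_face hF hv.1)
  obtain ⟨hvS, hsub⟩ := Set.insert_subset_iff.1 hsub
  have hvreg := h𝒮.ncard_inter hS hvS
  have hveq : (polyGraph P).neighborSet v ∩ faceVerts P F = (polyGraph P).neighborSet v ∩ S :=
    Set.eq_of_subset_of_ncard_le (Set.subset_inter Set.inter_subset_left hsub)
      (by rw [hvreg, hP.ncard_inter_face hF hv.1])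
  have hvsink : IsSinkOn (functionalOrientation P l) S v :=
    ⟨hvS, fun w hw h => hv.2 w (hveq.superset ⟨h.1, hw⟩).2 h⟩
  have hSF : S ⊆ faceVerts P F := by
    by_contra hnot
    -- The highest vertex of S outside F would be a second sink of S.
    obtain ⟨u, ⟨huS, huF⟩, hu⟩ := Set.Finite.exists_maximalFor (fun u : polyVertices P => l u)
      _ (Set.toFinite (S \ faceVerts P F)) (Set.sdiff_nonempty.2 hnot)
    have husink : IsSinkOn (functionalOrientation P l) S u := by
      refine ⟨huS, fun w hw h => ?_⟩
      by_cases hwF : w ∈ faceVerts P F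
      · exact (hinitial w hwF u huF).not_gt h.2
      · exact h.2.not_ge (hu ⟨hw, hwF⟩ h.2.le)
    exact huF ((huniq l hinj S hS).unique husink hvsink ▸ hv.1)
  have hFS : faceVerts P F ⊆ S := by
    by_contra hnot
    -- The highest vertex u of F outside S has a higher neighbour w in F, which lies in S. As S ⊆ F
    -- and both are k-regular at w, u lies in S.
    obtain ⟨u, ⟨huF, huS⟩, hu⟩ := Set.Finite.exists_maximalFor (fun u : polyVertices P => l u)
      _ (Set.toFinite (faceVerts P F \ S)) (Set.sdiff_nonempty.2 hnot)
    have hnsink : ¬ IsSinkOn (functionalOrientation P l) (faceVerts P F) u :=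
      fun h => huS (hvuniq u h ▸ hvS)
    have : ∃ w ∈ faceVerts P F, functionalOrientation P l u w := by
      by_contra! h
      exact hnsink ⟨huF, h⟩
    obtain ⟨w, hwF, huw⟩ := this
    have hwS : w ∈ S := by
      by_contra hwS
      exact huw.2.not_ge (hu ⟨hwF, hwS⟩ huw.2.le)
    have hweq : (polyGraph P).neighborSet w ∩ S =
        (polyGraph P).neighborSet w ∩ faceVerts P F :=
      Set.eq_of_subset_of_ncard_le (Set.inter_subset_inter_right _ hSF)
        (by rw [h𝒮.ncard_inter hS hwS, hP.ncard_inter_face hF hwF])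
    exact huS (hweq.superset ⟨huw.1.symm, huF⟩).2
  rw [hFS.antisymm hSF]
  exact hS

end Polytope

theorem mainTheorem1 {E : Type*} [NormedAddCommGroup E] [NormedSpace ℝ E] [FiniteDimensional ℝ E]
    (P : Set E) (d k : ℕ) (hP : IsSimplePolytope P d) (hk : 2 ≤ k) (hkd : k + 1 ≤ d) :
    (∀ 𝒮 : Set (Set (polyVertices P)), IsKSystem (polyGraph P) k 𝒮 →
      𝒮.ncard ≤ fNum P k ∧ (𝒮.ncard = fNum P k ↔ 𝒮 = kFaceVerts P k)) ∧
    (∀ O : polyVertices P → polyVertices P → Prop, IsAcyclicOrientation (polyGraph P) O →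
      fNum P k ≤ HkSum d k O ∧
      (fNum P k = HkSum d k O ↔ ∀ W ∈ kFaceVerts P k, ∃! v, IsSinkOn O W v)) := by
  have hfin := hP.polytope.finite_polyVertices
  have := hfin.to_subtype
  have hd : ∀ v, ((polyGraph P).neighborSet v).ncard ≤ d := fun v => (hP.degree_eq v).le
  have hsys := hP.isKSystem_kFaceVerts (k := k)
  refine ⟨fun 𝒮 h𝒮 => ?_, fun O hO => hsys.ncard_le_HkSum hO hd⟩
  have hH : ∀ l : E →L[ℝ] ℝ, Set.InjOn l (polyVertices P) →
      fNum P k = HkSum d k (functionalOrientation P l) := by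
    intro l hl
    refine (hsys.ncard_le_HkSum (isAcyclicOrientation_functionalOrientation hl) hd).2.2 ?_
    rintro _ ⟨F, hF, rfl⟩
    exact hP.polytope.existsUnique_isSinkOn hF.exposed hF.nonempty hl
  have hle := fun (l : E →L[ℝ] ℝ) (hl : Set.InjOn l (polyVertices P)) =>
    h𝒮.ncard_le_HkSum (isAcyclicOrientation_functionalOrientation hl) hd
  constructor
  -- Perturbing the zero functional yields some functional injective on the vertices.
  · obtain ⟨l, hl, -⟩ := exists_injOn_forall_lt hfin 0
    rw [hH l hl]
    exact (hle l hl).1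
  · constructor
    · intro heq
      have hsub := hP.kFaceVerts_subset h𝒮 fun l hl => (hle l hl).2.1 (heq.trans (hH l hl))
      exact (Set.eq_of_subset_of_ncard_le hsub heq.le).symm
    · rintro rfl
      rfl
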